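/- **Corollary 3.6 (rob(f) is a critical value).** Let $K$ be a finite geometric simplicial complex in some $\mathbb{R}^d$ with underlying space $|K|$, let $n\ge 1$, let $|\cdot|$ be an arbitrary norm on $\mathbb{R}^n$, and let $f:|K|\to\mathbb{R}^n$ be piecewise linear on $K$, i.e. affine on every simplex of $K$. For $\alpha\ge 0$, an $\alpha$-perturbation of $f$ is a continuous map $g:|K|\to\mathbb{R}^n$ with $|f(x)-g(x)|\le\alpha$ for all $x\in|K|$. A critical value of $f$ is a number of the form $\min_{x\in\Delta}|f(x)|$ with $\Delta$ a simplex of $K$. Suppose that $f$ has a root. Then: 1. The maximum $$\mathrm{rob}(f):=\max\{\alpha\ge 0 : \text{every $\alpha$-perturbation of $f$ has a root}\}$$ exists and is a critical value of $f$: $\mathrm{rob}(f)=\min_{x\in\Delta}|f(x)|$ for some simplex $\Delta$ of $K$. 2. $f$ has only finitely many critical values, and $\mathrm{rob}(f)$ is the largest critical value $a$ such that every $a$-perturbation of $f$ has a root. Consequently, given a list of the critical values of $f$ and a test that decides correctly, for each positive critical value $a$, whether every $a$-perturbation of $f$ has a root, the following finite procedure outputs $\mathrm{rob}(f)$ exactly: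 apply the test once to each positive entry of the list, and return the largest entry that passes, or $0$ if none passes. -/

import Mathlib

/-- `f : |K| → F` is piecewise linear on the simplicial complex `K`: on every simplex of `K` it
agrees with an affine map. -/
def IsPiecewiseLinear {E F : Type*} [AddCommGroup E] [Module ℝ E] [AddCommGroup F] [Module ℝ F]
    (K : Geometry.SimplicialComplex ℝ E) (f : K.space → F) : Prop :=
  ∀ s ∈ K.faces, ∃ A : E →ᵃ[ℝ] F,
    ∀ x : K.space, (x : E) ∈ convexHull ℝ (s : Set E) → f x = A x

/-- `g` is an `α`-perturbation of `f`: a continuous map with `‖f x - g x‖ ≤ α` for all `x`. -/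
def IsPerturbation {X F : Type*} [TopologicalSpace X] [NormedAddCommGroup F]
    (f : X → F) (α : ℝ) (g : X → F) : Prop :=
  Continuous g ∧ ∀ x, ‖f x - g x‖ ≤ α

/-- Every `α`-perturbation of `f` has a root. -/
def EveryPerturbationHasRoot {X F : Type*} [TopologicalSpace X] [NormedAddCommGroup F]
    (f : X → F) (α : ℝ) : Prop :=
  ∀ g : X → F, IsPerturbation f α g → ∃ x, g x = 0

/-- The set of all `α ≥ 0` such that every `α`-perturbation of `f` has a root. -/
def robustLevels {X F : Type*} [TopologicalSpace X] [NormedAddCommGroup F]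
    (f : X → F) : Set ℝ :=
  {α | 0 ≤ α ∧ EveryPerturbationHasRoot f α}

/-- The robustness of the root of `f`. It is written as a supremum; that it is a maximum is part
of what is claimed in the theorem. -/
noncomputable def rob {X F : Type*} [TopologicalSpace X] [NormedAddCommGroup F]
    (f : X → F) : ℝ :=
  sSup (robustLevels f)

/-- `a` is a critical value of `f`: `a = min_{x ∈ Δ} ‖f x‖` for some simplex `Δ` of `K`. -/
def IsCriticalValue {E F : Type*} [AddCommGroup E] [Module ℝ E] [NormedAddCommGroup F]
    (K : Geometry.SimplicialComplex ℝ E) (f : K.space → F) (a : ℝ) : Prop :=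
  ∃ s ∈ K.faces,
    IsLeast ((fun x : K.space => ‖f x‖) '' {x | (x : E) ∈ convexHull ℝ (s : Set E)}) a

/-- The procedure that runs through a finite list of numbers, applies `test` once to each positive
entry, and returns the largest positive entry that passes, or `0` if there is none. -/
noncomputable def largestPassing (test : ℝ → Bool) : List ℝ → ℝ
  | [] => 0
  | a :: L =>
    if 0 < a then
      if test a = true then max a (largestPassing test L) else largestPassing test L
    else largestPassing test L

/-!
Write `r = rob f`. On a compact space `r` is attained, by a limit argument (`isGreatest_rob`), so
the point is that `r` is a critical value; as `0` is one, `r > 0` may be assumed.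

Up to an arbitrarily small change of level, a root-free `α`-perturbation of `f` is the same thing as
a nowhere vanishing map `H` on `|K|` that equals `f` over `{α ≤ ‖f‖}`
(`IsPerturbation.exists_eq_of_lt`, `not_everyPerturbationHasRoot_of_eq`). Suppose that `r` is not a
critical value. Then every simplex containing a point with `‖f‖ = r` also contains, in the face that
carries the point, a point with `‖f‖ < r`. As `‖f‖` is convex on simplices, moving away from such
low points increases `‖f‖`, and doing so with speeds cut off by barycentric coordinates gives a
continuous self-map `φ` of `|K|` that sends `{r ≤ ‖f‖}` into `{r < ‖f‖}` and for which the segment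
from `f x` to `f (φ x)` avoids `0` over a neighbourhood of `{r ≤ ‖f‖}`
(`exists_push_of_not_isCriticalValue`). By compactness `φ` maps `{a ≤ ‖f‖}` into `{b ≤ ‖f‖}` for
some `a < r < b`. A root-free perturbation at a level between `r` and `b` gives a nowhere vanishing
`H` equal to `f` over `{b ≤ ‖f‖}`; then `H ∘ φ` is joined to `f` by segments avoiding `0` over
`{a ≤ ‖f‖}`, which yields a root-free `r`-perturbation (`rob_ne_of_push`). This contradicts that `r`
is attained.
-/

/-! ### Robust levels of a continuous map on a compact space -/

section Levels

variable {X F : Type*} [TopologicalSpace X] [NormedAddCommGroup F]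

theorem zero_mem_robustLevels {f : X → F} (hroot : ∃ x, f x = 0) : (0 : ℝ) ∈ robustLevels f := by
  refine ⟨le_rfl, fun g hg => ?_⟩
  obtain ⟨x, hx⟩ := hroot
  have h := norm_le_zero_iff.1 (hg.2 x)
  exact ⟨x, by rw [← sub_eq_zero.1 h, hx]⟩

/-- A nonzero constant map is a root-free perturbation of `f`, so the robust levels are bounded. -/
theorem bddAbove_robustLevels [CompactSpace X] [Nontrivial F] {f : X → F} (hf : Continuous f) :
    BddAbove (robustLevels f) := by
  obtain ⟨C, hC⟩ := isCompact_univ.exists_bound_of_continuousOn hf.continuousOn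
  obtain ⟨v, hv⟩ := exists_ne (0 : F)
  refine ⟨C + ‖v‖, fun α hα => ?_⟩
  by_contra! h
  obtain ⟨x, hx⟩ := hα.2 (fun _ => v) ⟨continuous_const, fun x =>
    (norm_sub_le _ _).trans ((add_le_add_left (hC x trivial) _).trans h.le)⟩
  exact hv hx

variable [NormedSpace ℝ F]

/-- The supremum of the robust levels is attained: an `α`-perturbation `g` is the limit of the
`tα`-perturbations `f + t • (g - f)`, `t → 1`, and roots survive the limit by compactness. -/
theorem isGreatest_rob [CompactSpace X] [Nontrivial F] {f : X → F} (hf : Continuous f)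
    (hroot : ∃ x, f x = 0) : IsGreatest (robustLevels f) (rob f) := by
  have h0 := zero_mem_robustLevels hroot
  have hbdd := bddAbove_robustLevels hf
  have hrob : 0 ≤ rob f := le_csSup hbdd h0
  refine ⟨⟨hrob, fun g hg => ?_⟩, fun α hα => le_csSup hbdd hα⟩
  by_contra! hne
  obtain ⟨x₀, hx₀⟩ := hroot
  obtain ⟨y, -, hy⟩ := isCompact_univ.exists_isMinOn ⟨x₀, trivial⟩ hg.1.norm.continuousOn
  have hm : 0 < ‖g y‖ := norm_pos_iff.2 (hne y)
  rcases hrob.eq_or_lt with h | h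
  · obtain ⟨x, hx⟩ := h0.2 g (by rwa [h])
    exact hne x hx
  -- A level close enough to the supremum that `f + t • (g - f)` is within `min ‖g‖` of `g`.
  have hlt : max 0 (rob f - ‖g y‖) < rob f := max_lt h (by linarith)
  obtain ⟨α, hα, hαlt⟩ := exists_lt_of_lt_csSup ⟨0, h0⟩ hlt
  have hα0 : 0 < α := (le_max_left _ _).trans_lt hαlt
  have hαm : rob f - ‖g y‖ < α := (le_max_right _ _).trans_lt hαlt
  have hαr : α ≤ rob f := le_csSup hbdd hα
  set t := α / rob f with ht
  have htr : t * rob f = α := div_mul_cancel₀ _ h.ne'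
  have ht0 : 0 ≤ t := by positivity
  have ht1 : t ≤ 1 := (div_le_one h).2 hαr
  obtain ⟨x, hx⟩ := hα.2 (fun x => f x + t • (g x - f x))
    ⟨hf.add ((hg.1.sub hf).const_smul t), fun x => by
      have h1 : f x - (f x + t • (g x - f x)) = t • (f x - g x) := by module
      rw [h1, norm_smul, Real.norm_of_nonneg ht0, ← htr]
      exact mul_le_mul_of_nonneg_left (hg.2 x) ht0⟩
  have h2 : g x = (1 - t) • (g x - f x) := by
    have : g x = (f x + t • (g x - f x)) + (1 - t) • (g x - f x) := by module
    rwa [hx, zero_add] at this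
  have h3 : ‖g x‖ ≤ (1 - t) * rob f := by
    rw [h2, norm_smul, Real.norm_of_nonneg (by linarith), norm_sub_rev]
    exact mul_le_mul_of_nonneg_left (hg.2 x) (by linarith)
  have h4 : ‖g y‖ ≤ ‖g x‖ := hy trivial
  nlinarith

/-- A nowhere vanishing map that is joined to `f` by segments avoiding `0` over `{a ≤ ‖f‖}` can be
replaced by a nowhere vanishing map that equals `f` over the smaller set `{b ≤ ‖f‖}`. -/
theorem exists_eq_of_segment_ne_zero {f h : X → F} (hf : Continuous f) (hh : Continuous h)
    (h0 : ∀ x, h x ≠ 0) {a b : ℝ} (hab : a < b)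
    (hseg : ∀ x, a ≤ ‖f x‖ → ∀ t ∈ Set.Icc (0 : ℝ) 1, (1 - t) • f x + t • h x ≠ 0) :
    ∃ H : X → F, Continuous H ∧ (∀ x, H x ≠ 0) ∧ ∀ x, b ≤ ‖f x‖ → H x = f x := by
  have hba : 0 < b - a := sub_pos.2 hab
  -- `θ` falls from `1` on `{‖f‖ ≤ a}` to `0` on `{b ≤ ‖f‖}`.
  set θ : X → ℝ := fun x => max 0 (min 1 ((b - ‖f x‖) / (b - a))) with hθ
  have hθc : Continuous θ :=
    continuous_const.max (continuous_const.min ((continuous_const.sub hf.norm).div_const _))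
  refine ⟨fun x => (1 - θ x) • f x + θ x • h x,
    ((continuous_const.sub hθc).smul hf).add (hθc.smul hh), fun x => ?_, fun x hx => ?_⟩
  · rcases le_total a ‖f x‖ with hx | hx
    · exact hseg x hx _ ⟨le_max_left _ _, max_le zero_le_one (min_le_left _ _)⟩
    · have : θ x = 1 := by
        have : 1 ≤ (b - ‖f x‖) / (b - a) := (one_le_div hba).2 (by linarith)
        simp [hθ, min_eq_left this]
      simpa [this] using h0 x
  · have : θ x = 0 :=
      max_eq_left ((min_le_right _ _).trans (div_nonpos_of_nonpos_of_nonneg (by linarith) hba.le))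
    simp [this]

theorem IsPerturbation.exists_eq_of_lt {f g : X → F} (hf : Continuous f) {β γ : ℝ}
    (hg : IsPerturbation f β g) (h0 : ∀ x, g x ≠ 0) (hβ : 0 ≤ β) (hβγ : β < γ) :
    ∃ H : X → F, Continuous H ∧ (∀ x, H x ≠ 0) ∧ ∀ x, γ ≤ ‖f x‖ → H x = f x := by
  refine exists_eq_of_segment_ne_zero hf hg.1 h0 (a := (β + γ) / 2) (by linarith) ?_
  intro x hx t ht h
  have h1 : f x = t • (f x - g x) := by
    have : f x = ((1 - t) • f x + t • g x) + t • (f x - g x) := by module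
    rwa [h, zero_add] at this
  have h2 : ‖f x‖ ≤ t * β := by
    conv_lhs => rw [h1]
    rw [norm_smul, Real.norm_of_nonneg ht.1]
    exact mul_le_mul_of_nonneg_left (hg.2 x) ht.1
  have h3 : t * β ≤ 1 * β := mul_le_mul_of_nonneg_right ht.2 hβ
  linarith

/-- A nowhere vanishing map equal to `f` over `{b ≤ ‖f‖}` gives a root-free `α`-perturbation of `f`
for every `α > b`. -/
theorem not_everyPerturbationHasRoot_of_eq [CompactSpace X] {f H : X → F} (hf : Continuous f)
    (hH : Continuous H) (h0 : ∀ x, H x ≠ 0) {b α : ℝ} (hb : 0 < b) (hbα : b < α)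
    (heq : ∀ x, b ≤ ‖f x‖ → H x = f x) : ¬ EveryPerturbationHasRoot f α := by
  obtain ⟨C, hC⟩ := isCompact_univ.exists_bound_of_continuousOn hH.continuousOn
  set ε := (α - b) / (|C| + 1) with hε
  have hC1 : 0 < |C| + 1 := by positivity
  have hε0 : 0 < ε := div_pos (by linarith) hC1
  have hεC : ∀ x, ε * ‖H x‖ ≤ α - b := fun x => by
    have h1 : ‖H x‖ ≤ |C| + 1 := (hC x trivial).trans (by linarith [le_abs_self C])
    calc ε * ‖H x‖ ≤ ε * (|C| + 1) := mul_le_mul_of_nonneg_left h1 hε0.le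
      _ = α - b := div_mul_cancel₀ _ hC1.ne'
  -- `f` shortened by `b` (and sent to `0` where `‖f‖ ≤ b`), plus a small multiple of `H`.
  set c : X → ℝ := fun x => b / max ‖f x‖ b with hc
  have hmax : ∀ x, 0 < max ‖f x‖ b := fun x => hb.trans_le (le_max_right _ _)
  have hcc : Continuous c :=
    continuous_const.div (hf.norm.max continuous_const) fun x => (hmax x).ne'
  have hc0 : ∀ x, 0 ≤ c x := fun x => div_nonneg hb.le (hmax x).le
  have hc1 : ∀ x, c x ≤ 1 := fun x => (div_le_one (hmax x)).2 (le_max_right _ _)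
  intro hall
  obtain ⟨x, hx⟩ := hall (fun x => ε • H x + (1 - c x) • f x)
    ⟨(hH.const_smul ε).add ((continuous_const.sub hcc).smul hf), fun x => by
      have h1 : f x - (ε • H x + (1 - c x) • f x) = c x • f x - ε • H x := by module
      have h2 : c x * ‖f x‖ ≤ b := by
        rw [hc, div_mul_eq_mul_div, div_le_iff₀ (hmax x)]
        exact mul_le_mul_of_nonneg_left (le_max_left _ _) hb.le
      rw [h1]
      refine (norm_sub_le _ _).trans ?_
      rw [norm_smul, norm_smul, Real.norm_of_nonneg (hc0 x), Real.norm_of_nonneg hε0.le]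
      linarith [hεC x]⟩
  rcases le_total b ‖f x‖ with h | h
  · have h1 : (ε + (1 - c x)) • f x = 0 := by rw [add_smul, ← heq x h]; rwa [← heq x h] at hx
    rcases smul_eq_zero.1 h1 with h2 | h2
    · linarith [hc1 x]
    · rw [h2, norm_zero] at h
      linarith
  · have h1 : c x = 1 := by
      rw [hc]
      simp only [max_eq_right h]
      exact div_self hb.ne'
    have h2 : ε • H x = 0 := by simpa [h1] using hx
    exact (smul_ne_zero hε0.ne' (h0 x)) h2

/-- If `f (φ x) = (1 + S) • f x - z` with `‖z‖ ≤ S * α`, strictly over `{‖f‖ = α}`, then the self-map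
`φ` pushes `{α ≤ ‖f‖}` into `{α < ‖f‖}` and does not turn values of `f` through `0`. Pulling back along `φ` then lowers
root-free perturbations from levels slightly above `α` to the level `α` itself. -/
theorem rob_ne_of_push [CompactSpace X] [Nontrivial F] {f : X → F} (hf : Continuous f)
    (hroot : ∃ x, f x = 0) {α : ℝ} (hα : 0 < α) {φ : X → X} (hφ : Continuous φ)
    (hpush : ∀ x, ∃ S : ℝ, ∃ z : F, 0 ≤ S ∧ S ≤ 1 ∧ f (φ x) = (1 + S) • f x - z ∧
      ‖z‖ ≤ S * α ∧ (‖f x‖ = α → ‖z‖ < S * α)) : rob f ≠ α := by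
  intro hrob
  have hgr := isGreatest_rob hf hroot
  have hnorm : ∀ x, ∀ S : ℝ, ∀ z : F, 0 ≤ S → f (φ x) = (1 + S) • f x - z →
      (1 + S) * ‖f x‖ - ‖z‖ ≤ ‖f (φ x)‖ := fun x S z hS h => by
    have := norm_sub_norm_le ((1 + S) • f x) z
    rwa [norm_smul, Real.norm_of_nonneg (by linarith), ← h] at this
  -- Either `‖f x‖ < α` or `α < ‖f (φ x)‖`; by compactness this holds with a uniform margin `η`.
  obtain ⟨x₀, -⟩ := id hroot
  obtain ⟨y, -, hy⟩ := isCompact_univ.exists_isMinOn ⟨x₀, trivial⟩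
    (f := fun x => max (α - ‖f x‖) (‖f (φ x)‖ - α))
    ((continuous_const.sub hf.norm).max
      ((hf.comp hφ).norm.sub continuous_const)).continuousOn
  set η := max (α - ‖f y‖) (‖f (φ y)‖ - α) with hη
  have hη0 : 0 < η := by
    obtain ⟨S, z, hS0, hS1, he, hz, hz'⟩ := hpush y
    have h1 := hnorm y S z hS0 he
    rcases lt_trichotomy ‖f y‖ α with h | h | h
    · exact lt_max_of_lt_left (by linarith)
    · refine lt_max_of_lt_right ?_
      have := hz' h
      rw [h] at h1
      linarith
    · refine lt_max_of_lt_right ?_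
      have : S * α ≤ S * ‖f y‖ := mul_le_mul_of_nonneg_left h.le hS0
      linarith
  have hφη : ∀ x, α - η < ‖f x‖ → α + η ≤ ‖f (φ x)‖ := fun x hx => by
    have h : η ≤ max (α - ‖f x‖) (‖f (φ x)‖ - α) := hy (Set.mem_univ x)
    rcases le_max_iff.1 h with h | h <;> linarith
  have hnot : ¬ EveryPerturbationHasRoot f (α + η / 2) := fun h => by
    have := hgr.2 (show α + η / 2 ∈ robustLevels f from ⟨by linarith, h⟩)
    linarith
  simp only [EveryPerturbationHasRoot, not_forall, not_exists] at hnot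
  obtain ⟨g, hg, hg0⟩ := hnot
  obtain ⟨H, hHc, hH0, hHf⟩ := hg.exists_eq_of_lt hf hg0 (by linarith)
    (show α + η / 2 < α + η by linarith)
  -- Beyond `α / 2` the segment from `f x` to `f (φ x)` misses `0`; the bound `3 / 4` leaves room.
  set a := max (α - η / 2) (3 / 4 * α) with ha
  have haα : a < α := max_lt (by linarith) (by linarith)
  have ha0 : 0 < a := lt_max_of_lt_right (by linarith)
  obtain ⟨H', hHc', hH0', hHf'⟩ := exists_eq_of_segment_ne_zero hf (hHc.comp hφ)
    (fun x => hH0 (φ x)) (show a < (a + α) / 2 by linarith) (by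
      intro x hx t ht h
      have hx1 : α - η / 2 ≤ ‖f x‖ := (le_max_left _ _).trans hx
      have hx2 : 3 / 4 * α ≤ ‖f x‖ := (le_max_right _ _).trans hx
      obtain ⟨S, z, hS0, hS1, he, hz, -⟩ := hpush x
      rw [Function.comp_apply, hHf _ (hφη x (by linarith)), he] at h
      have h1 : (1 + t * S) • f x = t • z := by
        rw [← sub_eq_zero, ← h]; module
      have h2 := congrArg norm h1
      have htS : 0 ≤ t * S := mul_nonneg ht.1 hS0
      have htS1 : t * S ≤ 1 := mul_le_one₀ ht.2 hS0 hS1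
      rw [norm_smul, norm_smul, Real.norm_of_nonneg (by linarith), Real.norm_of_nonneg ht.1] at h2
      have h3 : t * ‖z‖ ≤ t * (S * α) := mul_le_mul_of_nonneg_left hz ht.1
      nlinarith)
  exact not_everyPerturbationHasRoot_of_eq hf hHc' hH0' (by linarith)
    (show (a + α) / 2 < α by linarith) hHf' (hrob ▸ hgr.1.2)

end Levels

/-! ### Barycentric coordinates on a finite simplicial complex -/

section Complex

open Geometry

variable {E : Type*} [NormedAddCommGroup E] [NormedSpace ℝ E] {K : SimplicialComplex ℝ E}

theorem exists_affineMap_indicator [DecidableEq E] {s : Finset E}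
    (hs : AffineIndependent ℝ ((↑) : s → E)) (v : E) :
    ∃ A : E →ᵃ[ℝ] ℝ, ∀ w ∈ s, A w = if w = v then 1 else 0 := by
  by_cases hv : v ∈ s
  · obtain ⟨t, hst, ht, htop⟩ := exists_subset_affineIndependent_affineSpan_eq_top
      (k := ℝ) (s := (s : Set E)) hs
    let b : AffineBasis t ℝ E := ⟨(↑), ht, by rw [Subtype.range_coe, htop]⟩
    refine ⟨b.coord ⟨v, hst hv⟩, fun w hw => ?_⟩
    refine (b.coord_apply ⟨v, hst hv⟩ ⟨w, hst hw⟩).trans (if_congr ?_ rfl rfl)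
    rw [Subtype.mk.injEq, eq_comm]
  · refine ⟨AffineMap.const ℝ E 0, fun w hw => ?_⟩
    have : w ≠ v := fun h => hv (h ▸ hw)
    simp [this]

theorem AffineMap.map_sum_smul_of_sum_eq_one {G : Type*} [AddCommGroup G] [Module ℝ G]
    (A : E →ᵃ[ℝ] G) (s : Finset E) (a : E → ℝ) (ha : ∑ w ∈ s, a w = 1) :
    A (∑ w ∈ s, a w • w) = ∑ w ∈ s, a w • A w := by
  have h := s.map_affineCombination (fun w : E => w) a ha A
  rwa [s.affineCombination_eq_linear_combination _ _ ha,
    s.affineCombination_eq_linear_combination _ _ ha] at h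

theorem exists_mem_faces (x : K.space) : ∃ s ∈ K.faces, (x : E) ∈ convexHull ℝ (s : Set E) :=
  SimplicialComplex.mem_space_iff.1 x.2

theorem compactSpace_space (hK : K.faces.Finite) : CompactSpace K.space :=
  isCompact_iff_compactSpace.1 <|
    hK.isCompact_biUnion fun s _ => s.finite_toSet.isCompact_convexHull ℝ

theorem isClosed_simplex (s : Finset E) :
    IsClosed {x : K.space | (x : E) ∈ convexHull ℝ (s : Set E)} :=
  (s.finite_toSet.isCompact_convexHull ℝ).isClosed.preimage continuous_subtype_val

theorem IsPiecewiseLinear.continuous [FiniteDimensional ℝ E] {G : Type*}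
    [NormedAddCommGroup G] [NormedSpace ℝ G] (hK : K.faces.Finite) {f : K.space → G} (hf : IsPiecewiseLinear K f) : Continuous f := by
  have := hK.to_subtype
  refine (locallyFinite_of_finite
    fun s : K.faces => {x : K.space | (x : E) ∈ convexHull ℝ ((s : Finset E) : Set E)}).continuous
    ?_ (fun s => isClosed_simplex _) fun s => ?_
  · ext x
    simpa using exists_mem_faces x
  · obtain ⟨A, hA⟩ := hf s s.2
    exact (A.continuous_of_finiteDimensional.comp continuous_subtype_val).continuousOn.congr hA

/-- Barycentric coordinates: for each point of `|K|` a family of weights on the vertices, depending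
continuously on the point, which restricts on each simplex to the weights of its points and
vanishes off its vertices. On each simplex the coordinate of `v` is affine, and the affine maps of
two simplices agree on the vertices they share, hence on their intersection. -/
theorem exists_barycentric_coordinates [FiniteDimensional ℝ E] [DecidableEq E]
    (hK : K.faces.Finite) :
    ∃ l : K.space → E → ℝ, (∀ v, Continuous fun x => l x v) ∧
      ∀ s ∈ K.faces, ∀ a : E → ℝ, ∑ w ∈ s, a w = 1 → (∀ w ∈ s, 0 ≤ a w) → ∀ x : K.space,
        (x : E) = ∑ w ∈ s, a w • w → ∀ v, l x v = if v ∈ s then a v else 0 := by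
  choose A hA using fun (s : K.faces) (v : E) => exists_affineMap_indicator (K.indep s.2) v
  choose σ hσ hxσ using fun x : K.space => exists_mem_faces x
  set l : K.space → E → ℝ := fun x v => A ⟨σ x, hσ x⟩ v x with hl
  have hlA : ∀ (s : K.faces) (v : E) (x : K.space),
      (x : E) ∈ convexHull ℝ ((s : Finset E) : Set E) → l x v = A s v x := by
    intro s v x hx
    have hx' := K.inter_subset_convexHull (hσ x) s.2 ⟨hxσ x, hx⟩
    rw [← Finset.coe_inter, Finset.mem_convexHull'] at hx'
    obtain ⟨a, -, ha1, hax⟩ := hx'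
    rw [hl]
    simp only
    rw [← hax, AffineMap.map_sum_smul_of_sum_eq_one _ _ _ ha1,
      AffineMap.map_sum_smul_of_sum_eq_one _ _ _ ha1]
    refine Finset.sum_congr rfl fun w hw => ?_
    rw [hA _ v w (Finset.mem_inter.1 hw).1, hA _ v w (Finset.mem_inter.1 hw).2]
  refine ⟨l, fun v => ?_, fun s hs a ha1 ha0 x hx v => ?_⟩
  · exact IsPiecewiseLinear.continuous (f := fun x => l x v) hK
      fun s hs => ⟨A ⟨s, hs⟩ v, fun x hx => hlA ⟨s, hs⟩ v x hx⟩
  · rw [hlA ⟨s, hs⟩ v x (Finset.mem_convexHull'.2 ⟨a, ha0, ha1, hx.symm⟩), hx,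
      AffineMap.map_sum_smul_of_sum_eq_one _ _ _ ha1,
      Finset.sum_congr rfl fun w hw => by rw [hA ⟨s, hs⟩ v w hw]]
    simp

/-! ### Critical values -/

variable {F : Type*} [NormedAddCommGroup F]

theorem exists_isLeast_norm_simplex {f : K.space → F} (hf : Continuous f) (hK : K.faces.Finite)
    {s : Finset E} (hs : s ∈ K.faces) :
    ∃ x : K.space, (x : E) ∈ convexHull ℝ (s : Set E) ∧
      IsLeast ((fun x : K.space => ‖f x‖) '' {x | (x : E) ∈ convexHull ℝ (s : Set E)}) ‖f x‖ := by
  have := compactSpace_space hK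
  obtain ⟨v, hv⟩ := SimplicialComplex.nonempty_of_mem_faces hs
  obtain ⟨x, hx, hmin⟩ := (isClosed_simplex (K := K) s).isCompact.exists_isMinOn
    ⟨⟨v, K.subset_space hs hv⟩, subset_convexHull ℝ _ hv⟩ hf.norm.continuousOn
  refine ⟨x, hx, ⟨x, hx, rfl⟩, ?_⟩
  rintro _ ⟨y, hy, rfl⟩
  exact hmin hy

theorem finite_setOf_isCriticalValue (hK : K.faces.Finite) (f : K.space → F) :
    {a : ℝ | IsCriticalValue K f a}.Finite := by
  have : {a : ℝ | IsCriticalValue K f a} = ⋃ s ∈ K.faces, {a | IsLeast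
      ((fun x : K.space => ‖f x‖) '' {x | (x : E) ∈ convexHull ℝ (s : Set E)}) a} := by
    ext a
    simp [IsCriticalValue]
  rw [this]
  exact hK.biUnion fun s _ => Set.Subsingleton.finite fun a ha b hb => ha.unique hb

theorem IsCriticalValue.nonneg {f : K.space → F} {a : ℝ} (h : IsCriticalValue K f a) : 0 ≤ a := by
  obtain ⟨s, -, ⟨x, -, rfl⟩, -⟩ := h
  exact norm_nonneg _

theorem isCriticalValue_zero {f : K.space → F} (hroot : ∃ x, f x = 0) : IsCriticalValue K f 0 := by
  obtain ⟨x, hx⟩ := hroot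
  obtain ⟨s, hs, hxs⟩ := exists_mem_faces x
  refine ⟨s, hs, ⟨x, hxs, by simp [hx]⟩, ?_⟩
  rintro _ ⟨y, -, rfl⟩
  exact norm_nonneg _

/-! ### Pushing points across a level that is not critical -/

variable [FiniteDimensional ℝ E] [NormedSpace ℝ F]

/-- Away from critical values there is a continuous self-map of `|K|` that raises `‖f‖`. Each simplex
`Δ` that meets `{‖f‖ < α}` gets a base point `w Δ` there, and `x` is sent to
`x + ∑ Δ, ρ Δ x • (x - w Δ)`, where `ρ Δ x` is a multiple of the product of the barycentric
coordinates of `x` at the vertices of `Δ`. As `ρ Δ` vanishes unless `Δ` is a face of the simplex of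
`x` and is dominated by the coordinates of `x`, the image stays in every simplex containing `x`. If
`‖f x‖ = α`, then the simplex spanned by the vertices at which `x` has positive coordinates meets
`{‖f‖ < α}`, since its minimum is at most `α` and is not `α`, and its `ρ` is positive at `x`. -/
theorem exists_push_of_not_isCriticalValue (hK : K.faces.Finite) {f : K.space → F}
    (hf : IsPiecewiseLinear K f) {α : ℝ} (hcrit : ¬ IsCriticalValue K f α) :
    ∃ φ : K.space → K.space, Continuous φ ∧
      ∀ x, ∃ S : ℝ, ∃ z : F, 0 ≤ S ∧ S ≤ 1 ∧ f (φ x) = (1 + S) • f x - z ∧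
        ‖z‖ ≤ S * α ∧ (‖f x‖ = α → ‖z‖ < S * α) := by
  classical
  have hfc := hf.continuous hK
  obtain ⟨l, hlc, hl⟩ := exists_barycentric_coordinates hK
  obtain hE | ⟨⟨x₀⟩⟩ := isEmpty_or_nonempty K.space
  · exact ⟨id, continuous_id, fun x => hE.elim x⟩
  set T : Finset (Finset E) := hK.toFinset.filter
    (fun Δ => ∃ y : K.space, (y : E) ∈ convexHull ℝ (Δ : Set E) ∧ ‖f y‖ < α) with hT
  have hTf : ∀ Δ ∈ T, Δ ∈ K.faces := fun Δ h => by simpa using (Finset.mem_filter.1 h).1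
  have hw : ∀ Δ, ∃ y : K.space, Δ ∈ T → (y : E) ∈ convexHull ℝ (Δ : Set E) ∧ ‖f y‖ < α := by
    intro Δ
    by_cases h : Δ ∈ T
    · obtain ⟨y, hy⟩ := (Finset.mem_filter.1 h).2
      exact ⟨y, fun _ => hy⟩
    · exact ⟨x₀, fun h' => absurd h' h⟩
  choose w hw using hw
  set c : ℝ := 1 / (T.card + 1) with hc
  have hc0 : 0 < c := by positivity
  have hcT : T.card * c ≤ 1 := by
    rw [hc, mul_one_div, div_le_one (by positivity)]
    linarith
  set ρ : Finset E → K.space → ℝ := fun Δ x => c * ∏ v ∈ Δ, l x v with hρ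
  have hρc : ∀ Δ, Continuous (ρ Δ) := fun Δ =>
    continuous_const.mul (continuous_finsetProd _ fun v _ => hlc v)
  -- The coordinates in a simplex `s` containing `x`.
  have hcoord : ∀ s ∈ K.faces, ∀ x : K.space, (x : E) ∈ convexHull ℝ (s : Set E) →
      (∀ v, 0 ≤ l x v) ∧ (∀ v, l x v ≤ 1) ∧ (∀ v, v ∉ s → l x v = 0) ∧
      ∑ v ∈ s, l x v = 1 ∧ ∑ v ∈ s, l x v • v = (x : E) := by
    intro s hs x hx
    obtain ⟨a, ha0, ha1, hax⟩ := Finset.mem_convexHull'.1 hx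
    have h := hl s hs a ha1 ha0 x hax.symm
    have hle : ∀ v ∈ s, a v ≤ 1 := fun v hv => ha1 ▸ Finset.single_le_sum ha0 hv
    have hin : ∀ v ∈ s, l x v = a v := fun v hv => by rw [h v, if_pos hv]
    refine ⟨fun v => ?_, fun v => ?_, fun v hv => by rw [h v, if_neg hv], ?_, ?_⟩
    · rw [h v]; split_ifs with hv
      exacts [ha0 v hv, le_rfl]
    · rw [h v]; split_ifs with hv
      exacts [hle v hv, zero_le_one]
    · rw [← ha1]; exact Finset.sum_congr rfl hin
    · rw [← hax]; exact Finset.sum_congr rfl fun v hv => by rw [hin v hv]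
  have hl0 : ∀ x v, 0 ≤ l x v := fun x v => by
    obtain ⟨s, hs, hxs⟩ := exists_mem_faces x
    exact (hcoord s hs x hxs).1 v
  have hl1 : ∀ x v, l x v ≤ 1 := fun x v => by
    obtain ⟨s, hs, hxs⟩ := exists_mem_faces x
    exact (hcoord s hs x hxs).2.1 v
  have hρ0 : ∀ Δ x, 0 ≤ ρ Δ x := fun Δ x =>
    mul_nonneg hc0.le (Finset.prod_nonneg fun v _ => hl0 x v)
  have hρ1 : ∀ Δ x, ρ Δ x ≤ c := fun Δ x =>
    mul_le_of_le_one_right hc0.le (Finset.prod_le_one (fun v _ => hl0 x v) fun v _ => hl1 x v)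
  have hρl : ∀ Δ x, ∀ v ∈ Δ, ρ Δ x ≤ c * l x v := fun Δ x v hv => by
    refine mul_le_mul_of_nonneg_left ?_ hc0.le
    rw [← Finset.mul_prod_erase _ _ hv]
    exact mul_le_of_le_one_right (hl0 x v)
      (Finset.prod_le_one (fun u _ => hl0 x u) fun u _ => hl1 x u)
  -- A simplex containing `x` has all `Δ` with `ρ Δ x ≠ 0` as faces.
  have hsub : ∀ s ∈ K.faces, ∀ x : K.space, (x : E) ∈ convexHull ℝ (s : Set E) → ∀ Δ,
      ρ Δ x ≠ 0 → Δ ⊆ s := fun s hs x hx Δ h v hv => by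
    by_contra hvs
    have := hρl Δ x v hv
    rw [(hcoord s hs x hx).2.2.1 v hvs, mul_zero] at this
    exact h (le_antisymm this (hρ0 Δ x))
  set ψ : K.space → E := fun x => (x : E) + ∑ Δ ∈ T, ρ Δ x • ((x : E) - w Δ) with hψ
  have hψs : ∀ s ∈ K.faces, ∀ x : K.space, (x : E) ∈ convexHull ℝ (s : Set E) →
      ψ x ∈ convexHull ℝ (s : Set E) := by
    intro s hs x hx
    obtain ⟨-, -, -, hsum, hx'⟩ := hcoord s hs x hx
    have hwsum : ∀ Δ ∈ T, ρ Δ x ≠ 0 →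
        ∑ v ∈ s, l (w Δ) v = 1 ∧ ∑ v ∈ s, l (w Δ) v • v = (w Δ : E) := fun Δ hΔ h =>
      (hcoord s hs (w Δ) (convexHull_mono (hsub s hs x hx Δ h) (hw Δ hΔ).1)).2.2.2
    refine Finset.mem_convexHull'.2
      ⟨fun v => l x v + ∑ Δ ∈ T, ρ Δ x * (l x v - l (w Δ) v), fun v _ => ?_, ?_, ?_⟩
    · have h1 : ∀ Δ ∈ T, -(c * l x v) ≤ ρ Δ x * (l x v - l (w Δ) v) := fun Δ hΔ => by
        have hp := mul_nonneg (hρ0 Δ x) (hl0 x v)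
        by_cases hv : v ∈ Δ
        · have h2 := hρl Δ x v hv
          have h3 := mul_le_of_le_one_right (hρ0 Δ x) (hl1 (w Δ) v)
          rw [mul_sub]
          linarith
        · rw [(hcoord Δ (hTf Δ hΔ) (w Δ) (hw Δ hΔ).1).2.2.1 v hv, sub_zero]
          linarith [mul_nonneg hc0.le (hl0 x v)]
      have h2 := Finset.card_nsmul_le_sum T _ _ h1
      rw [nsmul_eq_mul] at h2
      have h3 := mul_le_mul_of_nonneg_right hcT (hl0 x v)
      linarith
    · rw [Finset.sum_add_distrib, hsum, Finset.sum_comm, Finset.sum_eq_zero, add_zero]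
      intro Δ hΔ
      rw [← Finset.mul_sum, Finset.sum_sub_distrib, hsum]
      by_cases h : ρ Δ x = 0
      · rw [h, zero_mul]
      · rw [(hwsum Δ hΔ h).1, sub_self, mul_zero]
    · simp_rw [add_smul, Finset.sum_add_distrib, hx', Finset.sum_smul]
      rw [Finset.sum_comm, hψ]
      refine congrArg _ (Finset.sum_congr rfl fun Δ hΔ => ?_)
      simp_rw [mul_smul, ← Finset.smul_sum, sub_smul, Finset.sum_sub_distrib, hx']
      by_cases h : ρ Δ x = 0
      · rw [h, zero_smul, zero_smul]
      · rw [(hwsum Δ hΔ h).2]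
  have hψK : ∀ x, ψ x ∈ K.space := fun x => by
    obtain ⟨s, hs, hx⟩ := exists_mem_faces x
    exact K.convexHull_subset_space hs (hψs s hs x hx)
  refine ⟨fun x => ⟨ψ x, hψK x⟩, ?_, fun x => ?_⟩
  · refine Continuous.subtype_mk (continuous_subtype_val.add ?_) _
    exact continuous_finsetSum _ fun Δ _ =>
      (hρc Δ).smul (continuous_subtype_val.sub continuous_const)
  obtain ⟨s, hs, hx⟩ := exists_mem_faces x
  refine ⟨∑ Δ ∈ T, ρ Δ x, ∑ Δ ∈ T, ρ Δ x • f (w Δ), Finset.sum_nonneg fun Δ _ => hρ0 Δ x,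
    ?_, ?_, ?_, fun hxα => ?_⟩
  · refine (Finset.sum_le_card_nsmul T _ c fun Δ _ => hρ1 Δ x).trans ?_
    rwa [nsmul_eq_mul]
  · obtain ⟨A, hA⟩ := hf s hs
    have h1 : A (ψ x) = A x + ∑ Δ ∈ T, ρ Δ x • (A x - A (w Δ)) := by
      have h2 := A.map_vadd (x : E) (∑ Δ ∈ T, ρ Δ x • ((x : E) - w Δ))
      rw [vadd_eq_add, vadd_eq_add, add_comm, add_comm _ (A x), map_sum] at h2
      rw [hψ]
      refine h2.trans (congrArg _ (Finset.sum_congr rfl fun Δ _ => ?_))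
      rw [map_smul, ← vsub_eq_sub (x : E), A.linearMap_vsub, vsub_eq_sub]
    rw [hA ⟨ψ x, hψK x⟩ (hψs s hs x hx), hA x hx, h1, add_smul, one_smul, Finset.sum_smul,
      add_sub_assoc, ← Finset.sum_sub_distrib]
    refine congrArg _ (Finset.sum_congr rfl fun Δ hΔ => ?_)
    by_cases h : ρ Δ x = 0
    · simp [h]
    · rw [hA (w Δ) (convexHull_mono (hsub s hs x hx Δ h) (hw Δ hΔ).1), smul_sub]
  · refine (norm_sum_le _ _).trans ?_
    rw [Finset.sum_mul]
    refine Finset.sum_le_sum fun Δ hΔ => ?_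
    rw [norm_smul, Real.norm_of_nonneg (hρ0 Δ x)]
    exact mul_le_mul_of_nonneg_left (hw Δ hΔ).2.le (hρ0 Δ x)
  · obtain ⟨-, -, -, hsum, hx'⟩ := hcoord s hs x hx
    set D : Finset E := s.filter fun v => 0 < l x v with hD
    have hD0 : ∀ v ∈ s, v ∉ D → l x v = 0 := fun v hv h =>
      le_antisymm (not_lt.1 fun h' => h (Finset.mem_filter.2 ⟨hv, h'⟩)) (hl0 x v)
    have hDsum : ∑ v ∈ D, l x v = 1 := by
      rw [← hsum]
      exact Finset.sum_subset (Finset.filter_subset _ _) hD0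
    have hDne : D.Nonempty := by
      rw [Finset.nonempty_iff_ne_empty]
      rintro h
      rw [h, Finset.sum_empty] at hDsum
      exact zero_ne_one hDsum
    have hDf : D ∈ K.faces := K.down_closed hs (Finset.filter_subset _ _) hDne
    have hxD : (x : E) ∈ convexHull ℝ (D : Set E) := by
      refine Finset.mem_convexHull'.2 ⟨l x, fun v _ => hl0 x v, hDsum, ?_⟩
      rw [← hx']
      exact Finset.sum_subset (Finset.filter_subset _ _) fun v hv h => by
        rw [hD0 v hv h, zero_smul]
    have hDT : D ∈ T := by
      obtain ⟨y, hyD, hy⟩ := exists_isLeast_norm_simplex hfc hK hDf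
      refine Finset.mem_filter.2 ⟨by simpa using hDf, y, hyD, lt_of_le_of_ne ?_ ?_⟩
      · exact hxα ▸ hy.2 ⟨x, hxD, rfl⟩
      · exact fun h => hcrit ⟨D, hDf, h ▸ hy⟩
    refine (norm_sum_le _ _).trans_lt ?_
    rw [Finset.sum_mul]
    refine Finset.sum_lt_sum (fun Δ hΔ => ?_) ⟨D, hDT, ?_⟩
    · rw [norm_smul, Real.norm_of_nonneg (hρ0 Δ x)]
      exact mul_le_mul_of_nonneg_left (hw Δ hΔ).2.le (hρ0 Δ x)
    · rw [norm_smul, Real.norm_of_nonneg (hρ0 D x)]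
      refine mul_lt_mul_of_pos_left (hw D hDT).2 (mul_pos hc0 (Finset.prod_pos fun v hv => ?_))
      exact (Finset.mem_filter.1 hv).2

theorem isCriticalValue_rob [Nontrivial F] (hK : K.faces.Finite) {f : K.space → F}
    (hf : IsPiecewiseLinear K f) (hroot : ∃ x, f x = 0) : IsCriticalValue K f (rob f) := by
  have := compactSpace_space hK
  have hfc := hf.continuous hK
  by_contra hcrit
  have h0 : 0 ≤ rob f := (isGreatest_rob hfc hroot).1.1
  have hpos : 0 < rob f := h0.lt_of_ne fun h => hcrit (h ▸ isCriticalValue_zero hroot)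
  obtain ⟨φ, hφ, hpush⟩ := exists_push_of_not_isCriticalValue hK hf hcrit
  exact rob_ne_of_push hfc hroot hpos hφ hpush rfl

end Complex

/-! ### The procedure -/

theorem largestPassing_nonneg (test : ℝ → Bool) (L : List ℝ) : 0 ≤ largestPassing test L := by
  induction L with
  | nil => exact le_rfl
  | cons a L ih =>
    simp only [largestPassing]
    split_ifs
    exacts [ih.trans (le_max_right _ _), ih, ih]

theorem le_largestPassing {test : ℝ → Bool} {L : List ℝ} {a : ℝ} (ha : a ∈ L) (h0 : 0 < a)
    (ht : test a = true) : a ≤ largestPassing test L := by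
  induction L with
  | nil => simp at ha
  | cons b L ih =>
    simp only [largestPassing]
    rcases List.mem_cons.1 ha with rfl | h
    · rw [if_pos h0, if_pos ht]
      exact le_max_left _ _
    · split_ifs
      exacts [(ih h).trans (le_max_right _ _), ih h, ih h]

theorem largestPassing_le {test : ℝ → Bool} {L : List ℝ} {r : ℝ} (hr : 0 ≤ r)
    (h : ∀ a ∈ L, 0 < a → test a = true → a ≤ r) : largestPassing test L ≤ r := by
  induction L with
  | nil => exact hr
  | cons b L ih =>
    have ih' := ih fun a ha => h a (List.mem_cons_of_mem _ ha)
    simp only [largestPassing]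
    split_ifs with h1 h2
    exacts [max_le (h b List.mem_cons_self h1 h2) ih', ih', ih']

/-! ### Robustness as the largest robust critical value -/

theorem corollary3p6 {d : ℕ} {F : Type*} [NormedAddCommGroup F] [NormedSpace ℝ F]
    [FiniteDimensional ℝ F] [Nontrivial F]
    (K : Geometry.SimplicialComplex ℝ (EuclideanSpace ℝ (Fin d))) (hK : K.faces.Finite)
    (f : K.space → F) (hf : IsPiecewiseLinear K f) (hroot : ∃ x, f x = 0) :
    -- the maximum that defines the robustness exists
    IsGreatest (robustLevels f) (rob f) ∧
    -- the robustness is a critical value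
    IsCriticalValue K f (rob f) ∧
    -- there are only finitely many critical values
    {a : ℝ | IsCriticalValue K f a}.Finite ∧
    -- the robustness is found by testing the critical values
    IsGreatest {a : ℝ | IsCriticalValue K f a ∧ EveryPerturbationHasRoot f a} (rob f) ∧
    ∀ L : List ℝ, (∀ a, a ∈ L ↔ IsCriticalValue K f a) →
      ∀ test : ℝ → Bool,
        (∀ a, IsCriticalValue K f a → 0 < a →
          (test a = true ↔ EveryPerturbationHasRoot f a)) →
        largestPassing test L = rob f := by
  have := compactSpace_space hK
  have hgr := isGreatest_rob (hf.continuous hK) hroot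
  have hcrit := isCriticalValue_rob hK hf hroot
  refine ⟨hgr, hcrit, finite_setOf_isCriticalValue hK f,
    ⟨⟨hcrit, hgr.1.2⟩, fun a ha => hgr.2 ⟨ha.1.nonneg, ha.2⟩⟩, fun L hL test htest => ?_⟩
  refine le_antisymm (largestPassing_le hgr.1.1 fun a ha h0 ht => ?_) ?_
  · exact hgr.2 ⟨h0.le, (htest a ((hL a).1 ha) h0).1 ht⟩
  · rcases hgr.1.1.eq_or_lt with h | h
    · exact h ▸ largestPassing_nonneg test L
    · exact le_largestPassing ((hL _).2 hcrit) h ((htest _ hcrit h).2 hgr.1.2)
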